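/- For a prime $p$ put $\gamma_p(z)=(1-p^{-z})^{-1}$, put $\gamma_\infty(z)=\pi^{-z/2}\Gamma(z/2)$, and for each place $v$ of $\mathbb Q$ let $\rho_v(z)=\gamma_v(z)/\gamma_v(1-z)$. Let $\mathbb C_-=\{z\in\mathbb C : \Re z<\tfrac12\}$, whose boundary is the critical line $\Re z=\tfrac12$ with Lebesgue measure, and let $\mathcal P$ be the orthogonal projection of $L^2(\partial\mathbb C_-)$ onto the Hardy space $H^2(\mathbb C_-)$ (the boundary values of the holomorphic functions on $\mathbb C_-$ whose $L^2$-norms on vertical lines are bounded). For $u\in L^\infty(\partial\mathbb C_-)$, acting on $L^2(\partial\mathbb C_-)$ by multiplication, the Sonin space $S(u)$ is the kernel of $u_{22}=(1-\mathcal P)\,u\,(1-\mathcal P)$ regarded as an operator on the range of $1-\mathcal P$, that is, $$S(u)=\{\xi\in(1-\mathcal P)L^2(\partial\mathbb C_-) : (1-\mathcal P)(u\xi)=0\}.$$ For a finite set $F$ of places of $\mathbb Q$ containing $\infty$, let $u(F)=\prod_{v\in F}\rho_v$, a function of modulus $1$ on the critical line. (i) For every finite set $F$ of places of $\mathbb Q$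 containing $\infty$, the Sonin space $S(u(F))$ is infinite dimensional (over $\mathbb C$). (ii) Let $F\subset F'$ be finite sets of places of $\mathbb Q$ containing $\infty$. Multiplication by $D(F,F')(z)=\prod_{p\in F'\setminus F}(1-p^{-z})$ defines an injective linear map $S(u(F))\to S(u(F'))$. Consequently the spaces $S(u(F))$ form a filtering inductive system under these maps: the finite sets of places containing $\infty$ are directed by inclusion, the map for $F=F'$ is the identity, and for $F\subset F'\subset F''$ the map $S(u(F))\to S(u(F''))$ is the composite of $S(u(F))\to S(u(F'))$ and $S(u(F'))\to S(u(F''))$. -/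

import Mathlib

open MeasureTheory Filter Topology
open scoped ENNReal

noncomputable section

namespace SemilocalSonin

/-- The places of `ℚ`: `none` is the archimedean place `∞`, `some p` is the prime `p`. -/
abbrev Place : Type := Option Nat.Primes

/-- The finite sets of places of `ℚ` that contain the archimedean place, ordered by inclusion. -/
abbrev FinPlaces : Type := {F : Finset Place // none ∈ F}

/-- The local factors `γ_∞(z) = π^{-z/2} Γ(z/2)` and `γ_p(z) = (1 - p^{-z})⁻¹`. -/
def localFactor : Place → ℂ → ℂ
  | none, z => (Real.pi : ℂ) ^ (-z / 2) * Complex.Gamma (z / 2)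
  | some p, z => (1 - ((p : ℕ) : ℂ) ^ (-z))⁻¹

/-- The ratio of local factors `ρ_v(z) = γ_v(z) / γ_v(1 - z)`. -/
def rho (v : Place) (z : ℂ) : ℂ := localFactor v z / localFactor v (1 - z)

/-- The product `u(F) = ∏_{v ∈ F} ρ_v`. -/
def uProd (F : Finset Place) (z : ℂ) : ℂ := ∏ v ∈ F, rho v z

/-- `D(F,F')(z) = ∏_p (1 - p^{-z})`, over the primes `p` in `F' \ F`. -/
def dProd (F F' : Finset Place) (z : ℂ) : ℂ :=
  ∏ p ∈ Finset.eraseNone (F' \ F), (1 - ((p : ℕ) : ℂ) ^ (-z))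

/-- The point `x + i s`; for fixed `x`, it parametrizes the vertical line `Re z = x`. -/
def vert (x s : ℝ) : ℂ := (x : ℂ) + (s : ℂ) * Complex.I

/-- The point `1/2 + i s` of the critical line, the boundary of `ℂ₋ = {Re z < 1/2}`. -/
def crit (s : ℝ) : ℂ := vert (1 / 2) s

/-- `L²(∂ℂ₋)`, the critical line being identified with `ℝ` through `s ↦ 1/2 + i s`. -/
abbrev L2 : Type := Lp ℂ 2 (volume : Measure ℝ)

/-- `f` is holomorphic in the half plane `Re z < 1/2`, its `L²` norms on vertical lines are
uniformly bounded, and `ξ` is its boundary value on the critical line (as a limit in `L²`). -/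
structure IsHardyExtension (f : ℂ → ℂ) (ξ : L2) : Prop where
  holo : DifferentiableOn ℂ f {z : ℂ | z.re < 1 / 2}
  bdd : ∃ C : ℝ≥0∞, C < ∞ ∧
    ∀ x : ℝ, x < 1 / 2 → eLpNorm (fun s : ℝ => f (vert x s)) 2 volume ≤ C
  boundary : Tendsto (fun x : ℝ => eLpNorm (fun s : ℝ => f (vert x s) - ξ s) 2 volume)
    (𝓝[<] (1 / 2 : ℝ)) (𝓝 0)

theorem continuous_vert (x : ℝ) : Continuous (vert x) := by
  unfold vert; fun_prop

theorem IsHardyExtension.aesm {f : ℂ → ℂ} {ξ : L2} (h : IsHardyExtension f ξ) {x : ℝ}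
    (hx : x < 1 / 2) : AEStronglyMeasurable (fun s : ℝ => f (vert x s)) volume := by
  refine Continuous.aestronglyMeasurable ?_
  refine h.holo.continuousOn.comp_continuous (continuous_vert x) ?_
  intro s
  simpa [vert] using hx

/-- The Hardy space `H²(ℂ₋)` as a space of boundary values inside `L²(∂ℂ₋)`. -/
def hardy : Submodule ℂ L2 where
  carrier := {ξ | ∃ f : ℂ → ℂ, IsHardyExtension f ξ}
  zero_mem' := by
    refine ⟨0, differentiableOn_const 0, ⟨0, by simp, by simp⟩, ?_⟩
    have : ∀ x : ℝ, eLpNorm (fun s : ℝ => (0 : ℂ → ℂ) (vert x s) - (0 : L2) s) 2 volume = 0 := by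
      intro x
      rw [← eLpNorm_zero (α := ℝ) (ε := ℂ) (p := 2) (μ := volume)]
      refine eLpNorm_congr_ae ?_
      filter_upwards [Lp.coeFn_zero ℂ 2 (volume : Measure ℝ)] with s hs
      simp [hs]
    simp only [this]
    exact tendsto_const_nhds
  add_mem' := by
    rintro ξ η ⟨f, hf⟩ ⟨g, hg⟩
    obtain ⟨C, hC, hfC⟩ := hf.bdd
    obtain ⟨D, hD, hgD⟩ := hg.bdd
    refine ⟨f + g, hf.holo.add hg.holo, ⟨C + D, ENNReal.add_lt_top.2 ⟨hC, hD⟩, ?_⟩, ?_⟩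
    · intro x hx
      exact (eLpNorm_add_le (hf.aesm hx) (hg.aesm hx) (by norm_num)).trans
        (add_le_add (hfC x hx) (hgD x hx))
    · have hlim := hf.boundary.add hg.boundary
      rw [add_zero] at hlim
      refine tendsto_of_tendsto_of_tendsto_of_le_of_le' tendsto_const_nhds hlim
        (Eventually.of_forall fun _ => zero_le) ?_
      filter_upwards [self_mem_nhdsWithin] with x hx
      refine le_trans (le_of_eq ?_) (eLpNorm_add_le
        ((hf.aesm hx).sub (Lp.aestronglyMeasurable ξ))
        ((hg.aesm hx).sub (Lp.aestronglyMeasurable η)) (by norm_num))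
      refine eLpNorm_congr_ae ?_
      filter_upwards [Lp.coeFn_add ξ η] with s hs
      simp only [hs, Pi.add_apply]
      ring
  smul_mem' := by
    rintro c ξ ⟨f, hf⟩
    obtain ⟨C, hC, hfC⟩ := hf.bdd
    refine ⟨c • f, hf.holo.const_smul c, ⟨‖c‖ₑ * C, ENNReal.mul_lt_top (by simp) hC, ?_⟩, ?_⟩
    · intro x hx
      have : eLpNorm (c • fun s : ℝ => f (vert x s)) 2 volume ≤ ‖c‖ₑ * C := by
        rw [eLpNorm_const_smul]
        gcongr
        exact hfC x hx
      exact this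
    · have hlim := ENNReal.Tendsto.const_mul (a := ‖c‖ₑ) hf.boundary (Or.inr (by simp))
      rw [mul_zero] at hlim
      refine hlim.congr fun x => ?_
      rw [← eLpNorm_const_smul]
      refine eLpNorm_congr_ae ?_
      filter_upwards [Lp.coeFn_smul c ξ] with s hs
      simp only [hs, Pi.smul_apply, smul_eq_mul]
      ring

/-- The orthogonal projection `P` of `L²(∂ℂ₋)` on `H²(ℂ₋)`. (The Hardy space is closed; the
closure is written only because orthogonal projections are defined for closed subspaces.) -/
def hardyProj : L2 →L[ℂ] L2 := hardy.topologicalClosure.starProjection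

/-- Multiplication by `u ∈ L^∞(∂ℂ₋)`, as a bounded operator on `L²(∂ℂ₋)`. -/
def mulOp (u : Lp ℂ ∞ (volume : Measure ℝ)) : L2 →L[ℂ] L2 :=
  (ContinuousLinearMap.mul ℂ ℂ).holderL volume ∞ 2 2 u

/-- The operator `(1 - P) u (1 - P)`. -/
def op22 (u : Lp ℂ ∞ (volume : Measure ℝ)) : L2 →L[ℂ] L2 :=
  (1 - hardyProj) ∘L mulOp u ∘L (1 - hardyProj)

/-- The Sonin space `S(u)`: the kernel of the matrix entry `u₂₂ = (1 - P) u (1 - P)`, an operator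
on the range of `1 - P`. -/
def sonin (u : Lp ℂ ∞ (volume : Measure ℝ)) : Submodule ℂ L2 :=
  LinearMap.range (1 - hardyProj : L2 →L[ℂ] L2).toLinearMap ⊓ LinearMap.ker (op22 u).toLinearMap

theorem one_sub_crit (s : ℝ) : 1 - crit s = (starRingEnd ℂ) (crit s) := by
  apply Complex.ext
  · simp [crit, vert]; norm_num
  · simp [crit, vert]

theorem localFactor_conj (v : Place) (z : ℂ) :
    localFactor v ((starRingEnd ℂ) z) = (starRingEnd ℂ) (localFactor v z) := by
  rcases v with _ | p
  · have h := Complex.cpow_conj (Real.pi : ℂ) (-z / 2)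
      (by rw [Complex.arg_ofReal_of_nonneg Real.pi_pos.le]; exact Real.pi_pos.ne)
    have h2 := Complex.Gamma_conj (z / 2)
    simp only [map_div₀, map_neg, Complex.conj_ofNat, Complex.conj_ofReal] at h h2
    simp only [localFactor, map_mul, h, h2]
  · have h := Complex.cpow_conj ((p : ℕ) : ℂ) (-z)
      (by rw [Complex.natCast_arg]; exact Real.pi_pos.ne)
    simp only [map_neg, Complex.conj_natCast] at h
    simp only [localFactor, map_inv₀, map_sub, map_one, h]

theorem norm_rho_crit_le (v : Place) (s : ℝ) : ‖rho v (crit s)‖ ≤ 1 := by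
  rw [rho, one_sub_crit, localFactor_conj, norm_div, RCLike.norm_conj]
  exact div_self_le_one _

theorem measurable_localFactor (v : Place) : Measurable (localFactor v) := by
  rcases v with _ | p
  · have h := Complex.differentiable_Gammaℝ_inv.continuous.measurable.inv
    have e : localFactor none = fun z : ℂ => ((Complex.Gammaℝ z)⁻¹)⁻¹ := by
      funext z
      rw [inv_inv]
      rfl
    rw [e]
    exact h
  · have hp : ((p : ℕ) : ℂ) ≠ 0 := by exact_mod_cast p.2.ne_zero
    have : Continuous fun z : ℂ => 1 - ((p : ℕ) : ℂ) ^ (-z) :=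
      continuous_const.sub (continuous_neg.const_cpow (Or.inl hp))
    exact this.measurable.inv

theorem memLp_uProd (F : Finset Place) :
    MemLp (fun s : ℝ => uProd F (crit s)) ∞ (volume : Measure ℝ) := by
  have hc : Measurable crit := (continuous_vert (1 / 2)).measurable
  have hm : Measurable fun s : ℝ => uProd F (crit s) := by
    unfold uProd rho
    refine Finset.measurable_fun_prod _ fun v _ => ?_
    exact ((measurable_localFactor v).comp hc).div
      ((measurable_localFactor v).comp (measurable_const.sub hc))
  refine memLp_top_of_bound hm.aestronglyMeasurable 1 (Eventually.of_forall fun s => ?_)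
  rw [uProd, norm_prod]
  exact Finset.prod_le_one (fun v _ => norm_nonneg _) fun v _ => norm_rho_crit_le v s

/-- The restriction of `u(F)` to the critical line, as an element of `L^∞(∂ℂ₋)`. -/
def uF (F : Finset Place) : Lp ℂ ∞ (volume : Measure ℝ) := (memLp_uProd F).toLp _

end SemilocalSonin

end

open SemilocalSonin

/-!
On the critical line `D(1 - z)` is the conjugate of `D(z)`, and `u(F') D(z) = D(1 - z) u(F)`. As
`D(1 - z)` is holomorphic and bounded on `ℂ₋`, multiplication by it preserves `H²`; hence its
adjoint, multiplication by `D`, preserves the orthogonal complement of `H²` and maps `S(u(F))` to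
`S(u(F'))`.

Because multiplication by `D` is injective, infinite dimensionality is needed only for `F = {∞}`.
Shifting the contour to `-∞` shows that `∫ ξ η = 0` over the critical line for `ξ, η ∈ H²`, so that
conjugates of elements of `H²` are orthogonal to `H²`. It remains to find many functions `g` such
that `g` and `g'`, `g'(1 - z) = ρ_∞(z) g(z)`, are both square integrable over the vertical lines to
the right of the critical line.

For an even function `Φ` on `ℤ/a²` with Fourier transform `Φ'` the functional equation says that
`ρ_∞(z) a^z L(Φ, z) = a⁻¹ a^(1 - z) L(Φ', 1 - z)`. Linear algebra gives `Φ ≠ 0` such that `Φ` and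
`Φ'` both vanish at `0, …, 3a - 1`, as soon as `4 · 3a < a²`, for which `a = 13` suffices. The
Dirichlet series then starts at `3a`, so that `a^z L(Φ, z)` is `O(3 ^ (-σ))`, up to a linear factor
in `z`. As `e < 3`, this pays for the growth `e ^ (σ / 2)` of the weight `(sinh(w/4) / w)²`,
`w = z - 1/2`, which makes the product square integrable on vertical lines, and it leaves room for
the factors `e ^ (δ z)`, `|δ| ≤ 1/2`. These are linearly independent.
-/

noncomputable section

namespace SemilocalSonin

section LpEstimates

variable {α : Type*} [MeasurableSpace α] {μ : Measure α} {p : ℝ≥0∞}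

theorem tendsto_eLpNorm_zero_of_dominated {ι E : Type*} [NormedAddCommGroup E] (hp : p ≠ ∞)
    {l : Filter ι} [l.IsCountablyGenerated] {F : ι → α → E} {b : α → ℝ}
    (hF : ∀ᶠ i in l, AEStronglyMeasurable (F i) μ) (hb : MemLp b p μ)
    (hle : ∀ᶠ i in l, ∀ᵐ a ∂μ, ‖F i a‖ ≤ b a)
    (hlim : ∀ᵐ a ∂μ, Tendsto (fun i => F i a) l (𝓝 0)) :
    Tendsto (fun i => eLpNorm (F i) p μ) l (𝓝 0) := by
  rcases eq_or_ne p 0 with rfl | hp0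
  · simp only [eLpNorm_exponent_zero, tendsto_const_nhds]
  have hp_pos : 0 < p.toReal := ENNReal.toReal_pos hp0 hp
  have hpow : Tendsto (fun i => ∫⁻ a, ‖F i a‖ₑ ^ p.toReal ∂μ) l (𝓝 (∫⁻ _, 0 ∂μ)) := by
    refine tendsto_lintegral_filter_of_dominated_convergence' (fun a => ‖b a‖ₑ ^ p.toReal)
      ?_ ?_ (lintegral_rpow_enorm_lt_top_of_eLpNorm_lt_top hp0 hp hb.2).ne ?_
    · filter_upwards [hF] with i hi using hi.enorm.pow_const _
    · filter_upwards [hle] with i hi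
      filter_upwards [hi] with a ha
      gcongr
      exact enorm_le_iff_norm_le.2 (ha.trans (le_abs_self _))
    · filter_upwards [hlim] with a ha
      simpa [Function.comp_def, ENNReal.zero_rpow_of_pos hp_pos] using
        (ENNReal.continuous_rpow_const (y := p.toReal)).continuousAt.tendsto.comp ha.enorm
  have hroot := (ENNReal.continuous_rpow_const (y := 1 / p.toReal)).continuousAt.tendsto.comp hpow
  rw [lintegral_zero, ENNReal.zero_rpow_of_pos (one_div_pos.2 hp_pos)] at hroot
  exact hroot.congr fun i => (eLpNorm_eq_lintegral_rpow_enorm_toReal hp0 hp).symm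

theorem eLpNorm_mul_sub_mul_le {f f' g g' : α → ℂ} (hf : AEStronglyMeasurable f μ)
    (hf' : AEStronglyMeasurable f' μ) (hg : AEStronglyMeasurable g μ)
    (hg' : AEStronglyMeasurable g' μ) (hp : 1 ≤ p) :
    eLpNorm (fun a => f a * g a - f' a * g' a) p μ ≤
      eLpNorm (fun a => f a * (g a - g' a)) p μ + eLpNorm (fun a => (f a - f' a) * g' a) p μ := by
  have hsplit : (fun a => f a * g a - f' a * g' a) =
      (fun a => f a * (g a - g' a)) + fun a => (f a - f' a) * g' a := by
    ext a
    simp only [Pi.add_apply]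
    ring
  rw [hsplit]
  exact eLpNorm_add_le (hf.mul (hg.sub hg')) ((hf.sub hf').mul hg') hp

theorem eLpNorm_one_mul_le {f g : α → ℂ} (hf : AEStronglyMeasurable f μ)
    (hg : AEStronglyMeasurable g μ) :
    eLpNorm (fun a => f a * g a) 1 μ ≤ eLpNorm f 2 μ * eLpNorm g 2 μ := by
  have hsmul : eLpNorm (f • g) 1 μ ≤ eLpNorm f 2 μ * eLpNorm g 2 μ :=
    eLpNorm_smul_le_mul_eLpNorm hg hf
  exact hsmul

end LpEstimates

theorem vert_re (x s : ℝ) : (vert x s).re = x := by simp [vert]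

theorem vert_im (x s : ℝ) : (vert x s).im = s := by simp [vert]

theorem crit_re (s : ℝ) : (crit s).re = 1 / 2 := vert_re _ _

theorem crit_im (s : ℝ) : (crit s).im = s := vert_im _ _

theorem continuous_crit : Continuous crit := continuous_vert _

theorem tendsto_vert_crit (s : ℝ) :
    Tendsto (fun x : ℝ => vert x s) (𝓝[<] (1 / 2 : ℝ)) (𝓝 (crit s)) := by
  have hcont : Continuous fun x : ℝ => vert x s := by unfold vert; fun_prop
  exact hcont.continuousAt.tendsto.mono_left nhdsWithin_le_nhds

section ContourShift

variable {h : ℂ → ℂ} {a : ℝ} {C : ℝ≥0∞}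

theorem integrable_vert (hh : DifferentiableOn ℂ h {z : ℂ | z.re < a}) (hC : C < ∞)
    (hbd : ∀ x < a, eLpNorm (fun s => h (vert x s)) 1 volume ≤ C) {x : ℝ} (hx : x < a) :
    Integrable fun s => h (vert x s) :=
  memLp_one_iff_integrable.1
    ⟨(hh.continuousOn.comp_continuous (continuous_vert x) fun s => by
      simpa only [Set.mem_ofPred_eq, vert_re] using hx).aestronglyMeasurable,
      (hbd x hx).trans_lt hC⟩

theorem integrable_vert_prod (hh : DifferentiableOn ℂ h {z : ℂ | z.re < a}) (hC : C < ∞)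
    (hbd : ∀ x < a, eLpNorm (fun s => h (vert x s)) 1 volume ≤ C) (x₀ : ℝ) {x₁ : ℝ}
    (h1 : x₁ < a) :
    Integrable (fun q : ℝ × ℝ => h (vert q.1 q.2))
      ((volume.restrict (Set.Ioc x₀ x₁)).prod volume) := by
  have hmeas : AEStronglyMeasurable (fun q : ℝ × ℝ => h (vert q.1 q.2))
      ((volume.restrict (Set.Ioc x₀ x₁)).prod volume) := by
    rw [Measure.restrict_prod_eq_prod_univ]
    refine ContinuousOn.aestronglyMeasurable ?_ (measurableSet_Ioc.prod MeasurableSet.univ)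
    refine hh.continuousOn.comp (Continuous.continuousOn ?_) fun q hq => ?_
    · unfold vert
      fun_prop
    · simpa only [Set.mem_ofPred_eq, vert_re] using hq.1.2.trans_lt h1
  refine ⟨hmeas, ?_⟩
  rw [HasFiniteIntegral, lintegral_prod _ hmeas.enorm]
  calc ∫⁻ x in Set.Ioc x₀ x₁, ∫⁻ s, ‖h (vert x s)‖ₑ
      ≤ ∫⁻ _x in Set.Ioc x₀ x₁, C := by
        refine setLIntegral_mono measurable_const fun x hx => ?_
        simpa only [eLpNorm_one_eq_lintegral_enorm] using hbd x (hx.2.trans_lt h1)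
    _ < ∞ := by
        rw [setLIntegral_const]
        exact ENNReal.mul_lt_top hC (by simp)

theorem integral_vert_eq (hh : DifferentiableOn ℂ h {z : ℂ | z.re < a}) (hC : C < ∞)
    (hbd : ∀ x < a, eLpNorm (fun s => h (vert x s)) 1 volume ≤ C) {x₀ x₁ : ℝ}
    (h01 : x₀ ≤ x₁) (h1 : x₁ < a) :
    ∫ s, h (vert x₀ s) = ∫ s, h (vert x₁ s) := by
  have hedge : Integrable fun T : ℝ => ∫ x in x₀..x₁, h (vert x T) := by
    simp only [intervalIntegral.integral_of_le h01]
    exact (integrable_vert_prod hh hC hbd x₀ h1).integral_prod_right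
  have hrect : ∀ T : ℝ, (∫ x in x₀..x₁, h (vert x (-T))) - (∫ x in x₀..x₁, h (vert x T)) =
      -(Complex.I • ((∫ s in (-T)..T, h (vert x₁ s)) - ∫ s in (-T)..T, h (vert x₀ s))) := by
    intro T
    have hr := Complex.integral_boundary_rect_eq_zero_of_differentiableOn h (vert x₀ (-T))
      (vert x₁ T) (hh.mono ?_)
    · simp only [vert_re, vert_im] at hr
      rw [smul_sub]
      simp only [vert] at hr ⊢
      linear_combination hr
    · rintro z ⟨hz, -⟩
      simp only [vert_re, Set.mem_preimage, Set.uIcc_of_le h01] at hz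
      exact hz.2.trans_lt h1
  have hline : ∀ x < a,
      Tendsto (fun T : ℝ => ∫ s in (-T)..T, h (vert x s)) atTop (𝓝 (∫ s, h (vert x s))) :=
    fun x hx => intervalIntegral_tendsto_integral (integrable_vert hh hC hbd hx)
      tendsto_neg_atTop_atBot tendsto_id
  have hlim : Tendsto (fun T : ℝ => (∫ x in x₀..x₁, h (vert x (-T))) - ∫ x in x₀..x₁, h (vert x T))
      atTop (𝓝 (-(Complex.I • ((∫ s, h (vert x₁ s)) - ∫ s, h (vert x₀ s))))) := by
    simp only [hrect]
    exact (((hline x₁ h1).sub (hline x₀ (h01.trans_lt h1))).const_smul _).neg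
  -- The horizontal edges are integrable in `T`, so a limit at infinity can only be zero.
  have hzero := ((hedge.comp_neg.sub hedge).integrableAtFilter atTop).eq_zero_of_tendsto
    (fun S hS => ?_) hlim
  · rw [neg_eq_zero, smul_eq_zero] at hzero
    exact (sub_eq_zero.1 (hzero.resolve_left Complex.I_ne_zero)).symm
  · obtain ⟨T, hT⟩ := mem_atTop_sets.1 hS
    exact top_unique (by rw [← Real.volume_Ici (a := T)]; exact measure_mono hT)

theorem norm_exp_mul_vert (δ x s : ℝ) : ‖Complex.exp (δ * vert x s)‖ = Real.exp (δ * x) := by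
  rw [Complex.norm_exp, Complex.re_ofReal_mul, vert_re]

theorem eLpNorm_exp_mul_vert (δ x : ℝ) (p : ℝ≥0∞) :
    eLpNorm (fun s => Complex.exp (δ * vert x s) * h (vert x s)) p volume =
      ENNReal.ofReal (Real.exp (δ * x)) * eLpNorm (fun s => h (vert x s)) p volume := by
  rw [← Real.enorm_of_nonneg (Real.exp_pos _).le, ← eLpNorm_const_smul]
  refine eLpNorm_congr_norm_ae (Eventually.of_forall fun s => ?_)
  rw [Pi.smul_apply, norm_mul, norm_smul, norm_exp_mul_vert,
    Real.norm_of_nonneg (Real.exp_pos _).le]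

theorem integral_exp_mul_vert_eq_zero (hh : DifferentiableOn ℂ h {z : ℂ | z.re < a}) (hC : C < ∞)
    (hbd : ∀ x < a, eLpNorm (fun s => h (vert x s)) 1 volume ≤ C) {δ : ℝ} (hδ : 0 < δ)
    {x : ℝ} (hx : x < a) : ∫ s, Complex.exp (δ * vert x s) * h (vert x s) = 0 := by
  have hexp : Differentiable ℂ fun z : ℂ => Complex.exp (δ * z) := by fun_prop
  have hbd' : ∀ y < a, eLpNorm (fun s => Complex.exp (δ * vert y s) * h (vert y s)) 1 volume ≤
      ENNReal.ofReal (Real.exp (δ * y)) * C := fun y hy => by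
    rw [eLpNorm_exp_mul_vert]
    gcongr
    exact hbd y hy
  have hlim : Tendsto (fun y : ℝ => ENNReal.ofReal (Real.exp (δ * y)) * C) atBot (𝓝 0) := by
    have := (Real.tendsto_exp_atBot.comp (tendsto_id.const_mul_atBot hδ))
    simpa using ENNReal.Tendsto.mul_const (ENNReal.tendsto_ofReal this) (Or.inr hC.ne)
  refine enorm_eq_zero.1 (le_zero_iff.1 (ge_of_tendsto hlim ?_))
  filter_upwards [eventually_le_atBot x] with y hy
  have hshift : ∫ s, Complex.exp (δ * vert y s) * h (vert y s) =
      ∫ s, Complex.exp (δ * vert x s) * h (vert x s) := by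
    refine integral_vert_eq (h := fun z => Complex.exp (δ * z) * h z)
      (hexp.differentiableOn.mul hh) (C := ENNReal.ofReal (Real.exp (δ * a)) * C)
      (ENNReal.mul_lt_top ENNReal.ofReal_lt_top hC) (fun t ht => (hbd' t ht).trans ?_) hy hx
    gcongr
  rw [← hshift]
  refine (enorm_integral_le_lintegral_enorm _).trans ?_
  rw [← eLpNorm_one_eq_lintegral_enorm]
  exact hbd' y (hy.trans_lt hx)

theorem integral_vert_eq_zero (hh : DifferentiableOn ℂ h {z : ℂ | z.re < a}) (hC : C < ∞)
    (hbd : ∀ x < a, eLpNorm (fun s => h (vert x s)) 1 volume ≤ C) {x : ℝ} (hx : x < a) :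
    ∫ s, h (vert x s) = 0 := by
  have hinteg := integrable_vert hh hC hbd hx
  have hlim : Tendsto (fun δ : ℝ => ∫ s, Complex.exp (δ * vert x s) * h (vert x s)) (𝓝[>] 0)
      (𝓝 (∫ s, h (vert x s))) := by
    refine tendsto_integral_filter_of_dominated_convergence
      (fun s => Real.exp |x| * ‖h (vert x s)‖) (Eventually.of_forall fun δ => ?_) ?_
      (hinteg.norm.const_mul _) (Eventually.of_forall fun s => ?_)
    · have : Continuous fun s => Complex.exp (δ * vert x s) := by unfold vert; fun_prop
      exact this.aestronglyMeasurable.mul hinteg.1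
    · filter_upwards [Ioc_mem_nhdsGT (zero_lt_one' ℝ)] with δ hδ
      refine Eventually.of_forall fun s => ?_
      rw [norm_mul, norm_exp_mul_vert]
      gcongr
      nlinarith [le_abs_self x, abs_nonneg x, hδ.1, hδ.2]
    · have hcont : Continuous fun δ : ℝ => Complex.exp (δ * vert x s) * h (vert x s) := by fun_prop
      simpa using (hcont.tendsto 0).mono_left nhdsWithin_le_nhds
  refine tendsto_nhds_unique hlim (tendsto_const_nhds.congr' ?_)
  filter_upwards [self_mem_nhdsWithin] with δ hδ
  exact (integral_exp_mul_vert_eq_zero hh hC hbd hδ hx).symm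

end ContourShift

theorem IsHardyExtension.tendsto_eLpNorm_mul_sub_mul {f g : ℂ → ℂ} {ξ η : L2}
    (hf : IsHardyExtension f ξ) (hg : IsHardyExtension g η) :
    Tendsto (fun x : ℝ => eLpNorm (fun s => f (vert x s) * g (vert x s) - ξ s * η s) 1 volume)
      (𝓝[<] (1 / 2 : ℝ)) (𝓝 0) := by
  obtain ⟨C, hC, hfC⟩ := hf.bdd
  have hξ := Lp.aestronglyMeasurable ξ
  have hη := Lp.aestronglyMeasurable η
  have hlim : Tendsto (fun x : ℝ => C * eLpNorm (fun s => g (vert x s) - η s) 2 volume +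
      eLpNorm (fun s => f (vert x s) - ξ s) 2 volume * eLpNorm η 2 volume)
      (𝓝[<] (1 / 2 : ℝ)) (𝓝 0) := by
    simpa using (ENNReal.Tendsto.const_mul hg.boundary (Or.inr hC.ne)).add
      (ENNReal.Tendsto.mul_const hf.boundary (Or.inr (Lp.memLp η).2.ne))
  refine tendsto_of_tendsto_of_tendsto_of_le_of_le' tendsto_const_nhds hlim
    (Eventually.of_forall fun _ => zero_le) ?_
  filter_upwards [self_mem_nhdsWithin] with x hx
  have hfx := hf.aesm hx
  have hgx := hg.aesm hx
  refine (eLpNorm_mul_sub_mul_le hfx hξ hgx hη le_rfl).trans (add_le_add ?_ ?_)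
  · refine (eLpNorm_one_mul_le hfx (hgx.sub hη)).trans ?_
    gcongr
    exacts [hfC x hx, le_rfl]
  · exact eLpNorm_one_mul_le (hfx.sub hξ) hη

theorem integral_mul_eq_zero_of_mem_hardy {ξ η : L2} (hξ : ξ ∈ hardy) (hη : η ∈ hardy) :
    ∫ s, ξ s * η s = 0 := by
  obtain ⟨f, hf⟩ := hξ
  obtain ⟨g, hg⟩ := hη
  obtain ⟨C, hC, hfC⟩ := hf.bdd
  obtain ⟨D, hD, hgD⟩ := hg.bdd
  have hfg : DifferentiableOn ℂ (fun z => f z * g z) {z : ℂ | z.re < 1 / 2} := hf.holo.mul hg.holo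
  have hCD : C * D < ∞ := ENNReal.mul_lt_top hC hD
  have hbd : ∀ x : ℝ, x < 1 / 2 → eLpNorm (fun s => f (vert x s) * g (vert x s)) 1 volume ≤ C * D :=
    fun x hx => (eLpNorm_one_mul_le (hf.aesm hx) (hg.aesm hx)).trans
      (mul_le_mul' (hfC x hx) (hgD x hx))
  have hlim : Tendsto (fun x : ℝ => ∫ s, f (vert x s) * g (vert x s)) (𝓝[<] (1 / 2 : ℝ))
      (𝓝 (∫ s, ξ s * η s)) := by
    refine tendsto_integral_of_L1' _
      ((Lp.aestronglyMeasurable ξ).mul (Lp.aestronglyMeasurable η)) ?_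
      (hf.tendsto_eLpNorm_mul_sub_mul hg)
    filter_upwards [self_mem_nhdsWithin] with x hx using integrable_vert hfg hCD hbd hx
  refine tendsto_nhds_unique hlim (tendsto_const_nhds.congr' ?_)
  filter_upwards [self_mem_nhdsWithin] with x hx
  exact (integral_vert_eq_zero hfg hCD hbd hx).symm

theorem star_mem_hardy_orthogonal {ξ : L2} (hξ : ξ ∈ hardy) : star ξ ∈ hardyᗮ := by
  refine (Submodule.mem_orthogonal' _ _).2 fun η hη => ?_
  rw [L2.inner_def, ← integral_mul_eq_zero_of_mem_hardy hη hξ]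
  refine integral_congr_ae ?_
  filter_upwards [Lp.coeFn_star ξ] with s hs
  rw [RCLike.inner_apply, hs, Pi.star_apply, ← starRingEnd_apply, Complex.conj_conj]

section Multiplier

variable {m : ℂ → ℂ} {B : ℝ}

theorem eLpNorm_mul_vert_le (hB : ∀ z : ℂ, z.re ≤ 1 / 2 → ‖m z‖ ≤ B) {x : ℝ} (hx : x ≤ 1 / 2)
    (g : ℝ → ℂ) (p : ℝ≥0∞) :
    eLpNorm (fun s => m (vert x s) * g s) p volume ≤ ENNReal.ofReal B * eLpNorm g p volume := by
  refine eLpNorm_le_mul_eLpNorm_of_ae_le_mul (Eventually.of_forall fun s => ?_) p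
  rw [norm_mul]
  gcongr
  exact hB _ (by rwa [vert_re])

theorem tendsto_eLpNorm_sub_crit_mul (hm : Continuous m)
    (hB : ∀ z : ℂ, z.re ≤ 1 / 2 → ‖m z‖ ≤ B) {p : ℝ≥0∞} (hp : p ≠ ∞) {ξ : ℝ → ℂ}
    (hξ : MemLp ξ p volume) :
    Tendsto (fun x : ℝ => eLpNorm (fun s => (m (vert x s) - m (crit s)) * ξ s) p volume)
      (𝓝[<] (1 / 2 : ℝ)) (𝓝 0) := by
  refine tendsto_eLpNorm_zero_of_dominated (b := fun s => 2 * B * ‖ξ s‖) hp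
    (Eventually.of_forall fun x => ?_) (hξ.norm.const_mul _) ?_ (Eventually.of_forall fun s => ?_)
  · exact ((hm.comp (continuous_vert x)).sub
      (hm.comp continuous_crit)).aestronglyMeasurable.mul hξ.1
  · filter_upwards [self_mem_nhdsWithin] with x hx
    refine Eventually.of_forall fun s => ?_
    rw [norm_mul, two_mul]
    gcongr
    exact norm_sub_le_of_le (hB _ (by rw [vert_re]; exact le_of_lt hx)) (hB _ (crit_re s).le)
  · have hsub := ((hm.tendsto (crit s)).comp (tendsto_vert_crit s)).sub_const (m (crit s))
    simpa using hsub.mul_const (ξ s)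

theorem mem_hardy_of_ae_eq_mul (hm : Differentiable ℂ m)
    (hB : ∀ z : ℂ, z.re ≤ 1 / 2 → ‖m z‖ ≤ B) {ξ η : L2} (hξ : ξ ∈ hardy)
    (hη : η =ᵐ[volume] fun s => m (crit s) * ξ s) : η ∈ hardy := by
  obtain ⟨f, hf⟩ := hξ
  obtain ⟨C, hC, hfC⟩ := hf.bdd
  refine ⟨fun z => m z * f z, hm.differentiableOn.mul hf.holo,
    ⟨ENNReal.ofReal B * C, ENNReal.mul_lt_top ENNReal.ofReal_lt_top hC, fun x hx => ?_⟩, ?_⟩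
  · refine (eLpNorm_mul_vert_le hB hx.le (fun s => f (vert x s)) 2).trans ?_
    gcongr
    exact hfC x hx
  have hlim : Tendsto (fun x : ℝ =>
      ENNReal.ofReal B * eLpNorm (fun s => f (vert x s) - ξ s) 2 volume +
      eLpNorm (fun s => (m (vert x s) - m (crit s)) * ξ s) 2 volume)
      (𝓝[<] (1 / 2 : ℝ)) (𝓝 0) := by
    simpa using (ENNReal.Tendsto.const_mul hf.boundary (Or.inr ENNReal.ofReal_ne_top)).add
      (tendsto_eLpNorm_sub_crit_mul hm.continuous hB ENNReal.ofNat_ne_top (Lp.memLp ξ))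
  refine tendsto_of_tendsto_of_tendsto_of_le_of_le' tendsto_const_nhds hlim
    (Eventually.of_forall fun _ => zero_le) ?_
  filter_upwards [self_mem_nhdsWithin] with x hx
  have hmx := (hm.continuous.comp (continuous_vert x)).aestronglyMeasurable (μ := volume)
  have hmc := (hm.continuous.comp continuous_crit).aestronglyMeasurable (μ := volume)
  calc eLpNorm (fun s => m (vert x s) * f (vert x s) - η s) 2 volume
      = eLpNorm (fun s => m (vert x s) * f (vert x s) - m (crit s) * ξ s) 2 volume :=
        eLpNorm_congr_ae (by filter_upwards [hη] with s hs; rw [hs])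
    _ ≤ eLpNorm (fun s => m (vert x s) * (f (vert x s) - ξ s)) 2 volume +
          eLpNorm (fun s => (m (vert x s) - m (crit s)) * ξ s) 2 volume :=
        eLpNorm_mul_sub_mul_le hmx hmc (hf.aesm hx) (Lp.aestronglyMeasurable ξ) one_le_two
    _ ≤ _ := by
        gcongr
        exact eLpNorm_mul_vert_le hB (le_of_lt hx) _ 2

end Multiplier

theorem mulOp_apply (u : Lp ℂ ∞ (volume : Measure ℝ)) (ξ : L2) :
    mulOp u ξ =ᵐ[volume] fun s => u s * ξ s := by
  filter_upwards [(ContinuousLinearMap.mul ℂ ℂ).coeFn_holder (r := 2) u ξ] with s hs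
  exact hs

theorem mulOp_toLp {φ : ℝ → ℂ} (hφ : MemLp φ ∞ (volume : Measure ℝ)) (ξ : L2) :
    mulOp (hφ.toLp φ) ξ =ᵐ[volume] fun s => φ s * ξ s := by
  filter_upwards [mulOp_apply (hφ.toLp φ) ξ, hφ.coeFn_toLp] with s h1 h2
  rw [h1, h2]

theorem mem_sonin_iff (u : Lp ℂ ∞ (volume : Measure ℝ)) (ξ : L2) :
    ξ ∈ sonin u ↔ ξ ∈ hardyᗮ ∧ mulOp u ξ ∈ hardy.topologicalClosure := by
  have hP : (1 - hardyProj : L2 →L[ℂ] L2) = (hardy.topologicalClosure)ᗮ.starProjection :=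
    (Submodule.starProjection_orthogonal' _).symm
  have hcl : (hardy.topologicalClosure)ᗮ = hardyᗮ := hardy.orthogonal_closure
  have hrange : ξ ∈ LinearMap.range (1 - hardyProj : L2 →L[ℂ] L2).toLinearMap ↔ ξ ∈ hardyᗮ := by
    rw [hP, ← hcl]
    exact iff_of_eq (congrArg (ξ ∈ ·) (Submodule.range_starProjection _))
  rw [sonin, Submodule.mem_inf, hrange, and_congr_right_iff]
  intro hξ
  rw [LinearMap.mem_ker]
  have h1 : (1 - hardyProj : L2 →L[ℂ] L2) ξ = ξ := by
    rw [hP]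
    exact Submodule.starProjection_eq_self_iff.2 (hcl ▸ hξ)
  have h2 : op22 u ξ = (1 - hardyProj : L2 →L[ℂ] L2) (mulOp u ξ) := by
    rw [op22, ContinuousLinearMap.comp_apply, ContinuousLinearMap.comp_apply, h1]
  change op22 u ξ = 0 ↔ _
  rw [h2, hP, Submodule.starProjection_apply_eq_zero_iff, Submodule.orthogonal_orthogonal]

theorem inner_mulOp (d : Lp ℂ ∞ (volume : Measure ℝ)) (ξ η : L2) :
    inner ℂ η (mulOp d ξ) = inner ℂ (mulOp (star d) η) ξ := by
  rw [L2.inner_def, L2.inner_def]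
  refine integral_congr_ae ?_
  filter_upwards [mulOp_apply d ξ, mulOp_apply (star d) η, Lp.coeFn_star d] with s h1 h2 h3
  rw [h1, h2, h3, Pi.star_apply, ← starRingEnd_apply]
  simp only [RCLike.inner_apply, map_mul, Complex.conj_conj]
  ring

theorem mulOp_mem_sonin {u u' d : Lp ℂ ∞ (volume : Measure ℝ)}
    (hd : ∀ η ∈ hardy, mulOp (star d) η ∈ hardy)
    (hu : ∀ᵐ s : ℝ, u' s * d s = star (d s) * u s) {ξ : L2} (hξ : ξ ∈ sonin u) :
    mulOp d ξ ∈ sonin u' := by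
  rw [mem_sonin_iff] at hξ ⊢
  refine ⟨(Submodule.mem_orthogonal _ _).2 fun η hη => ?_, ?_⟩
  · rw [inner_mulOp]
    exact (Submodule.mem_orthogonal _ _).1 hξ.1 _ (hd η hη)
  · have hcomm : mulOp u' (mulOp d ξ) = mulOp (star d) (mulOp u ξ) := by
      refine Lp.ext ?_
      filter_upwards [mulOp_apply u' (mulOp d ξ), mulOp_apply d ξ, Lp.coeFn_star d,
        mulOp_apply (star d) (mulOp u ξ), mulOp_apply u ξ, hu] with s h1 h2 h3 h4 h5 h6
      rw [h1, h2, h4, h5, h3, Pi.star_apply, ← mul_assoc, h6, mul_assoc]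
    rw [hcomm]
    exact map_mem_closure (mulOp (star d)).continuous hξ.2 hd

theorem norm_prime_cpow (p : Nat.Primes) (z : ℂ) :
    ‖((p : ℕ) : ℂ) ^ z‖ = ((p : ℕ) : ℝ) ^ z.re := by
  rw [Complex.norm_natCast_cpow_of_pos p.2.pos]

theorem differentiable_dProd (F F' : Finset Place) : Differentiable ℂ (dProd F F') := by
  unfold dProd
  refine Differentiable.fun_finsetProd fun p _ => ?_
  refine (differentiable_const _).sub (Differentiable.const_cpow differentiable_neg (Or.inl ?_))
  exact_mod_cast p.2.ne_zero

theorem norm_dProd_le (F F' : Finset Place) {z : ℂ} (hz : 0 ≤ z.re) :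
    ‖dProd F F' z‖ ≤ ∏ _p ∈ Finset.eraseNone (F' \ F), 2 := by
  rw [dProd, norm_prod]
  refine Finset.prod_le_prod (fun p _ => norm_nonneg _) fun p _ => ?_
  refine (norm_sub_le _ _).trans ?_
  rw [norm_one, norm_prime_cpow, Complex.neg_re]
  have := Real.rpow_le_one_of_one_le_of_nonpos (x := ((p : ℕ) : ℝ)) (z := -z.re)
    (by exact_mod_cast p.2.one_lt.le) (by linarith)
  linarith

theorem one_sub_prime_cpow_ne_zero (p : Nat.Primes) {z : ℂ} (hz : 0 < z.re) :
    1 - ((p : ℕ) : ℂ) ^ (-z) ≠ 0 := by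
  intro h
  have h1 : ‖((p : ℕ) : ℂ) ^ (-z)‖ = 1 := by rw [← sub_eq_zero.1 h, norm_one]
  rw [norm_prime_cpow, Complex.neg_re] at h1
  have := Real.rpow_lt_one_of_one_lt_of_neg (x := ((p : ℕ) : ℝ)) (z := -z.re)
    (by exact_mod_cast p.2.one_lt) (by linarith)
  linarith

theorem dProd_ne_zero (F F' : Finset Place) {z : ℂ} (hz : 0 < z.re) : dProd F F' z ≠ 0 :=
  Finset.prod_ne_zero_iff.2 fun p _ => one_sub_prime_cpow_ne_zero p hz

theorem dProd_one_sub_crit (F F' : Finset Place) (s : ℝ) :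
    dProd F F' (1 - crit s) = (starRingEnd ℂ) (dProd F F' (crit s)) := by
  rw [one_sub_crit, dProd, dProd, map_prod]
  refine Finset.prod_congr rfl fun p _ => ?_
  have h := localFactor_conj (some p) (crit s)
  simp only [localFactor, map_inv₀] at h
  exact inv_injective h

theorem memLp_dProd (F F' : Finset Place) :
    MemLp (fun s : ℝ => dProd F F' (crit s)) ∞ (volume : Measure ℝ) :=
  memLp_top_of_bound
    ((differentiable_dProd F F').continuous.comp continuous_crit).aestronglyMeasurable _
    (Eventually.of_forall fun s => norm_dProd_le F F' (by rw [crit_re]; norm_num))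

/-- The restriction of `D(F,F')` to the critical line, as an element of `L^∞(∂ℂ₋)`. -/
def dF (F F' : Finset Place) : Lp ℂ ∞ (volume : Measure ℝ) := (memLp_dProd F F').toLp _

theorem mulOp_dF (F F' : Finset Place) (ξ : L2) :
    mulOp (dF F F') ξ =ᵐ[volume] fun s => dProd F F' (crit s) * ξ s := mulOp_toLp _ ξ

theorem mulOp_star_dF_mem_hardy (F F' : Finset Place) {ξ : L2} (hξ : ξ ∈ hardy) :
    mulOp (star (dF F F')) ξ ∈ hardy := by
  refine mem_hardy_of_ae_eq_mul (m := fun z => dProd F F' (1 - z))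
    ((differentiable_dProd F F').comp ((differentiable_const _).sub differentiable_id))
    (fun z hz => norm_dProd_le F F' ?_) hξ ?_
  · rw [Complex.sub_re, Complex.one_re]
    linarith
  · filter_upwards [mulOp_apply (star (dF F F')) ξ, Lp.coeFn_star (dF F F'),
      (memLp_dProd F F').coeFn_toLp] with s h1 h2 h3
    rw [h1, h2, Pi.star_apply, dF, h3, dProd_one_sub_crit, starRingEnd_apply]

theorem dProd_eq_prod {F : Finset Place} (hF : none ∈ F) (F' : Finset Place) (z : ℂ) :
    dProd F F' z = ∏ v ∈ F' \ F, (localFactor v z)⁻¹ := by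
  have hnone : none ∉ F' \ F := fun h => (Finset.mem_sdiff.1 h).2 hF
  have hmap : (Finset.eraseNone (F' \ F)).map Function.Embedding.some = F' \ F := by
    rw [Finset.map_some_eraseNone, Finset.erase_eq_of_notMem hnone]
  rw [dProd, ← hmap, Finset.prod_map, hmap]
  simp [localFactor]

theorem uProd_mul_dProd {F F' : FinPlaces} (h : F ≤ F') (s : ℝ) :
    uProd F'.1 (crit s) * dProd F.1 F'.1 (crit s) =
      dProd F.1 F'.1 (1 - crit s) * uProd F.1 (crit s) := by
  have huF' : uProd F'.1 (crit s) = (∏ v ∈ F'.1 \ F.1, rho v (crit s)) * uProd F.1 (crit s) :=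
    (Finset.prod_sdiff h).symm
  rw [huF', dProd_eq_prod F.2, dProd_eq_prod F.2, mul_right_comm, ← Finset.prod_mul_distrib]
  congr 1
  refine Finset.prod_congr rfl fun v hv => ?_
  have hloc : localFactor v (crit s) ≠ 0 := by
    rcases v with _ | p
    · simp [F.2] at hv
    · exact inv_ne_zero (one_sub_prime_cpow_ne_zero p (by rw [crit_re]; norm_num))
  rw [rho]
  field_simp

theorem mulOp_dF_mem_sonin {F F' : FinPlaces} (h : F ≤ F') {ξ : L2} (hξ : ξ ∈ sonin (uF F.1)) :
    mulOp (dF F.1 F'.1) ξ ∈ sonin (uF F'.1) := by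
  refine mulOp_mem_sonin (fun η hη => mulOp_star_dF_mem_hardy _ _ hη) ?_ hξ
  filter_upwards [(memLp_uProd F.1).coeFn_toLp, (memLp_uProd F'.1).coeFn_toLp,
    (memLp_dProd F.1 F'.1).coeFn_toLp] with s h1 h2 h3
  rw [uF, uF, dF, h1, h2, h3, uProd_mul_dProd h, dProd_one_sub_crit, starRingEnd_apply]

/-- Multiplication by `D(F,F')` as a map `S(u(F)) → S(u(F'))`. -/
def soninMap (F F' : FinPlaces) (h : F ≤ F') : sonin (uF F.1) →ₗ[ℂ] sonin (uF F'.1) :=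
  (mulOp (dF F.1 F'.1)).toLinearMap.restrict fun _ hξ => mulOp_dF_mem_sonin h hξ

theorem soninMap_apply (F F' : FinPlaces) (h : F ≤ F') (ξ : sonin (uF F.1)) :
    ((soninMap F F' h ξ : L2) : ℝ → ℂ) =ᵐ[volume]
      fun s : ℝ => dProd F.1 F'.1 (crit s) * (ξ : L2) s := mulOp_dF _ _ _

theorem soninMap_injective (F F' : FinPlaces) (h : F ≤ F') :
    Function.Injective (soninMap F F' h) := by
  intro ξ η he
  refine Subtype.ext (Lp.ext ?_)
  have h2 := soninMap_apply F F' h η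
  rw [← he] at h2
  filter_upwards [soninMap_apply F F' h ξ, h2] with s h1 h2
  exact mul_left_cancel₀ (dProd_ne_zero F.1 F'.1 (by rw [crit_re]; norm_num)) (h1.symm.trans h2)

theorem dProd_self (F : Finset Place) (z : ℂ) : dProd F F z = 1 := by simp [dProd]

theorem dProd_mul_dProd {F F' F'' : Finset Place} (h : F ⊆ F') (h' : F' ⊆ F'') (z : ℂ) :
    dProd F' F'' z * dProd F F' z = dProd F F'' z := by
  rw [dProd, dProd, dProd, ← Finset.prod_union]
  · congr 1
    ext p
    have hp := @h (some p)
    have hp' := @h' (some p)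
    simp only [Finset.mem_union, Finset.mem_eraseNone, Finset.mem_sdiff]
    tauto
  · rw [Finset.disjoint_left]
    intro p h1 h2
    exact (Finset.mem_sdiff.1 (Finset.mem_eraseNone.1 h1)).2
      (Finset.mem_sdiff.1 (Finset.mem_eraseNone.1 h2)).1

theorem directedSystem_soninMap :
    DirectedSystem (fun F : FinPlaces => sonin (uF F.1)) (fun F F' h => soninMap F F' h) where
  map_self F ξ := by
    refine Subtype.ext (Lp.ext ?_)
    filter_upwards [soninMap_apply F F le_rfl ξ] with s hs
    rw [hs, dProd_self, one_mul]
  map_map F₃ F₂ F₁ h h' ξ := by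
    refine Subtype.ext (Lp.ext ?_)
    filter_upwards [soninMap_apply F₂ F₃ h' (soninMap F₁ F₂ h ξ), soninMap_apply F₁ F₂ h ξ,
      soninMap_apply F₁ F₃ (h.trans h') ξ] with s h1 h2 h3
    rw [h1, h2, h3, ← mul_assoc, dProd_mul_dProd h h']

theorem isDirectedOrder_finPlaces : IsDirectedOrder FinPlaces where
  directed F F' := ⟨⟨F.1 ∪ F'.1, Finset.mem_union_left _ F.2⟩,
    Finset.subset_union_left, Finset.subset_union_right⟩

section EntireSonin

variable {g : ℂ → ℂ}

/-- The entire functions whose restrictions to the vertical lines of the half plane `Re z ≥ 1/2`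
have a common majorant in `L²`. -/
def dominated : Submodule ℂ (ℂ → ℂ) where
  carrier := {g | Differentiable ℂ g ∧
    ∃ b : ℝ → ℝ, MemLp b 2 volume ∧ ∀ z : ℂ, 1 / 2 ≤ z.re → ‖g z‖ ≤ b z.im}
  zero_mem' := ⟨differentiable_const 0, 0, MemLp.zero, fun z _ => by simp⟩
  add_mem' := by
    rintro f g ⟨hf, b, hb, hfb⟩ ⟨hg, b', hb', hgb'⟩
    exact ⟨hf.add hg, b + b', hb.add hb', fun z hz => norm_add_le_of_le (hfb z hz) (hgb' z hz)⟩
  smul_mem' := by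
    rintro c g ⟨hg, b, hb, hgb⟩
    refine ⟨hg.const_smul c, fun s => ‖c‖ * b s, hb.const_mul _, fun z hz => ?_⟩
    rw [Pi.smul_apply, norm_smul]
    exact mul_le_mul_of_nonneg_left (hgb z hz) (norm_nonneg c)

theorem memLp_crit (hg : g ∈ dominated) : MemLp (fun s => g (crit s)) 2 volume := by
  obtain ⟨hdiff, b, hb, hgb⟩ := hg
  refine hb.mono (hdiff.continuous.comp continuous_crit).aestronglyMeasurable
    (Eventually.of_forall fun s => ?_)
  have hs := hgb (crit s) (crit_re s).ge
  rw [crit_im] at hs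
  exact hs.trans (le_abs_self _)

theorem mem_hardy_of_dominated (hg : g ∈ dominated) {ξ : L2}
    (hξ : ξ =ᵐ[volume] fun s => g (1 - crit s)) : ξ ∈ hardy := by
  obtain ⟨hdiff, b, hb, hgb⟩ := hg
  have hb_neg : MemLp (fun s => b (-s)) 2 volume :=
    hb.comp_measurePreserving (Measure.measurePreserving_neg volume)
  have hle : ∀ x ≤ (1 / 2 : ℝ), ∀ s, ‖g (1 - vert x s)‖ ≤ b (-s) := fun x hx s => by
    have hs := hgb (1 - vert x s) (by rw [Complex.sub_re, vert_re, Complex.one_re]; linarith)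
    rwa [Complex.sub_im, vert_im, Complex.one_im, zero_sub] at hs
  have hrefl : Differentiable ℂ fun z : ℂ => g (1 - z) :=
    hdiff.comp ((differentiable_const 1).sub differentiable_id)
  refine ⟨fun z => g (1 - z), hrefl.differentiableOn, ⟨_, hb_neg.2, fun x hx =>
    eLpNorm_mono_real (hle x hx.le)⟩, ?_⟩
  refine tendsto_eLpNorm_zero_of_dominated (b := fun s => b (-s) + b (-s)) ENNReal.ofNat_ne_top
    (Eventually.of_forall fun x => ?_) (hb_neg.add hb_neg) ?_ ?_
  · exact (hrefl.continuous.comp (continuous_vert x)).aestronglyMeasurable.sub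
      (Lp.aestronglyMeasurable ξ)
  · filter_upwards [self_mem_nhdsWithin] with x hx
    filter_upwards [hξ] with s hs
    rw [hs]
    exact norm_sub_le_of_le (hle x (le_of_lt hx) s) (hle _ le_rfl s)
  · filter_upwards [hξ] with s hs
    rw [hs]
    simpa using ((hrefl.continuous.tendsto (crit s)).comp (tendsto_vert_crit s)).sub_const
      (g (1 - crit s))

theorem conj_conj_mem_dominated (hg : g ∈ dominated) :
    (starRingEnd ℂ ∘ g ∘ starRingEnd ℂ) ∈ dominated := by
  obtain ⟨hdiff, b, hb, hgb⟩ := hg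
  refine ⟨fun z => differentiableAt_conj_conj_iff.2 (hdiff _), fun s => b (-s),
    hb.comp_measurePreserving (Measure.measurePreserving_neg volume), fun z hz => ?_⟩
  simpa using hgb (starRingEnd ℂ z) (by simpa using hz)

theorem mem_hardy_orthogonal_of_dominated (hg : g ∈ dominated) {ξ : L2}
    (hξ : ξ =ᵐ[volume] fun s => g (crit s)) : ξ ∈ hardyᗮ := by
  rw [← star_star ξ]
  refine star_mem_hardy_orthogonal (mem_hardy_of_dominated (conj_conj_mem_dominated hg) ?_)
  filter_upwards [Lp.coeFn_star ξ, hξ] with s h1 h2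
  simp [h1, h2, one_sub_crit]

/-- Entire functions with restrictions to the critical line in `S(u({∞}))`: both `g` and the entire
function `g'` with `ρ_∞(z) g(z) = g'(1 - z)` are dominated on `Re z ≥ 1/2`. -/
def soninEntire : Submodule ℂ (ℂ → ℂ) where
  carrier := {g | g ∈ dominated ∧
    ∃ g' ∈ dominated, ∀ s, rho none (crit s) * g (crit s) = g' (1 - crit s)}
  zero_mem' := ⟨dominated.zero_mem, 0, dominated.zero_mem, by simp⟩
  add_mem' := by
    rintro f g ⟨hf, f', hf', hff'⟩ ⟨hg, g', hg', hgg'⟩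
    refine ⟨dominated.add_mem hf hg, f' + g', dominated.add_mem hf' hg', fun s => ?_⟩
    rw [Pi.add_apply, Pi.add_apply, mul_add, hff', hgg']
  smul_mem' := by
    rintro c g ⟨hg, g', hg', hgg'⟩
    refine ⟨dominated.smul_mem c hg, c • g', dominated.smul_mem c hg', fun s => ?_⟩
    rw [Pi.smul_apply, Pi.smul_apply, ← hgg', mul_smul_comm]

theorem toLp_mem_sonin (hg : g ∈ soninEntire) :
    (memLp_crit hg.1).toLp _ ∈ sonin (uF {none}) := by
  have hae := (memLp_crit hg.1).coeFn_toLp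
  obtain ⟨g', hg', hgg'⟩ := hg.2
  refine (mem_sonin_iff _ _).2 ⟨mem_hardy_orthogonal_of_dominated hg.1 hae,
    hardy.le_topologicalClosure (mem_hardy_of_dominated hg' ?_)⟩
  filter_upwards [hae, mulOp_toLp (memLp_uProd {none}) ((memLp_crit hg.1).toLp _)] with s h1 h2
  rw [uF, h2, h1, uProd, Finset.prod_singleton, hgg']

/-- Restriction to the critical line, as a map from `soninEntire` to `S(u({∞}))`. -/
def toSonin : soninEntire →ₗ[ℂ] sonin (uF {none}) where
  toFun g := ⟨_, toLp_mem_sonin g.2⟩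
  map_add' _ _ := rfl
  map_smul' _ _ := rfl

theorem eq_zero_of_crit (hg : Differentiable ℂ g) (h : ∀ s, g (crit s) = 0) : g = 0 := by
  have hinj : Function.Injective crit := fun s t hst => by
    simpa only [crit_im] using congrArg Complex.im hst
  have hlim : Tendsto crit (𝓝[≠] 0) (𝓝[≠] (crit 0)) :=
    continuous_crit.continuousAt.continuousWithinAt.tendsto_nhdsWithin
      fun s hs hs' => hs (hinj hs')
  exact AnalyticOnNhd.eq_of_frequently_eq
    (hg.differentiableOn.analyticOnNhd isOpen_univ) analyticOnNhd_const
    (hlim.frequently (Eventually.of_forall (p := fun s => g (crit s) = 0) h).frequently)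

theorem toSonin_injective : Function.Injective toSonin := by
  refine (injective_iff_map_eq_zero _).2 fun g hg => Subtype.ext (eq_zero_of_crit g.2.1.1 ?_)
  have hae : (fun s => g.1 (crit s)) =ᵐ[volume] fun _ => 0 := by
    have hLp : (memLp_crit g.2.1).toLp _ = 0 := congrArg Subtype.val hg
    filter_upwards [(memLp_crit g.2.1).coeFn_toLp, Lp.coeFn_zero ℂ 2 (volume : Measure ℝ)]
      with s h1 h2
    rw [← h1, hLp, h2, Pi.zero_apply]
  exact congrFun (((g.2.1.1.continuous.comp continuous_crit).ae_eq_iff_eq volume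
    continuous_const).1 hae)

end EntireSonin

section PeriodicCoefficients

variable {N : ℕ} [NeZero N]

theorem exists_even_eq_zero_dft_eq_zero {A : ℕ} (hA : 4 * A < N) :
    ∃ Φ : ZMod N → ℂ, Φ ≠ 0 ∧ Φ.Even ∧ (∀ k < A, Φ (k : ZMod N) = 0) ∧
      ∀ k < A, ZMod.dft Φ (k : ZMod N) = 0 := by
  let absIndex : ZMod N → Fin (N / 2 + 1) := fun j =>
    ⟨j.valMinAbs.natAbs, Nat.lt_succ_of_le (ZMod.natAbs_valMinAbs_le j)⟩
  have hsurj : Function.Surjective absIndex := fun i => ⟨(i : ℕ), Fin.ext <| by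
    simp [absIndex, ZMod.valMinAbs_natCast_of_le_half (Nat.lt_succ_iff.1 i.2)]⟩
  let ofAbs : (Fin (N / 2 + 1) → ℂ) →ₗ[ℂ] ZMod N → ℂ := LinearMap.funLeft ℂ ℂ absIndex
  let initial : (ZMod N → ℂ) →ₗ[ℂ] Fin A → ℂ := LinearMap.funLeft ℂ ℂ fun k => ((k : ℕ) : ZMod N)
  have hker : LinearMap.ker ((initial.prod (initial ∘ₗ ZMod.dft.toLinearMap)) ∘ₗ ofAbs) ≠ ⊥ := by
    -- Even functions have `N / 2 + 1` free values, more than the `2 * A` conditions.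
    refine LinearMap.ker_ne_bot_of_finrank_lt ?_
    rw [Module.finrank_prod, Module.finrank_fin_fun, Module.finrank_fin_fun]
    omega
  obtain ⟨c, hc, hc0⟩ := Submodule.exists_mem_ne_zero_of_ne_bot hker
  obtain ⟨hΦ, hdft⟩ := Prod.ext_iff.1 (LinearMap.mem_ker.1 hc)
  refine ⟨ofAbs c, ?_, fun j => ?_, fun k hk => congrFun hΦ ⟨k, hk⟩,
    fun k hk => congrFun hdft ⟨k, hk⟩⟩
  · exact (map_ne_zero_iff _ (LinearMap.funLeft_injective_of_surjective ℂ ℂ _ hsurj)).2 hc0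
  · simp only [ofAbs, absIndex, LinearMap.funLeft_apply, ZMod.natAbs_valMinAbs_neg]

theorem sum_range_natCast_zmod {M : Type*} [AddCommMonoid M] (Φ : ZMod N → M) :
    ∑ k ∈ Finset.range N, Φ (k : ZMod N) = ∑ j, Φ j :=
  Finset.sum_nbij' (fun k => (k : ZMod N)) ZMod.val (by simp)
    (fun j _ => Finset.mem_range.2 j.val_lt)
    (fun k hk => ZMod.val_cast_of_lt (Finset.mem_range.1 hk)) (by simp) (by simp)

theorem exists_norm_sum_Icc_le {E : Type*} [SeminormedAddCommGroup E] {Φ : ZMod N → E}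
    (hΦ : ∑ j, Φ j = 0) : ∃ B : ℝ, ∀ n : ℕ, ‖∑ k ∈ Finset.Icc 1 n, Φ (k : ZMod N)‖ ≤ B := by
  have hper : Function.Periodic (fun n => ∑ k ∈ Finset.range n, Φ ((k + 1 : ℕ) : ZMod N)) N := by
    intro n
    have hshift : ∑ k ∈ Finset.range N, Φ ((n + k + 1 : ℕ) : ZMod N) = 0 := by
      rw [← hΦ, ← Equiv.sum_comp (Equiv.addLeft ((n + 1 : ℕ) : ZMod N)) Φ,
        ← sum_range_natCast_zmod]
      simp [add_assoc, add_comm]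
    simp only [Finset.sum_range_add, hshift, add_zero]
  refine ⟨∑ m ∈ Finset.range N, ‖∑ k ∈ Finset.range m, Φ ((k + 1 : ℕ) : ZMod N)‖, fun n => ?_⟩
  have hIcc : ∑ k ∈ Finset.Icc 1 n, Φ (k : ZMod N) =
      ∑ k ∈ Finset.range n, Φ ((k + 1 : ℕ) : ZMod N) := by
    rw [Finset.range_eq_Ico, Finset.sum_Ico_add' (fun k : ℕ => Φ (k : ZMod N)), zero_add,
      Finset.Ico_add_one_right_eq_Icc]
  rw [hIcc, ← hper.map_mod_nat n]
  exact Finset.single_le_sum (f := fun m => ‖∑ k ∈ Finset.range m, Φ ((k + 1 : ℕ) : ZMod N)‖)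
    (fun _ _ => norm_nonneg _) (Finset.mem_range.2 (Nat.mod_lt _ (NeZero.pos N)))

end PeriodicCoefficients

section DirichletSeriesBound

variable {f : ℕ → ℂ} {B : ℝ}

/-- The summatory function `t ↦ ∑_{1 ≤ k ≤ t} f k` of a sequence. -/
def summatory (f : ℕ → ℂ) (t : ℝ) : ℂ := ∑ k ∈ Finset.Icc 1 ⌊t⌋₊, f k

theorem measurable_summatory (f : ℕ → ℂ) : Measurable (summatory f) :=
  (measurable_of_countable fun n => ∑ k ∈ Finset.Icc 1 n, f k).comp Nat.measurable_floor

theorem summatory_eq_zero {A : ℝ} (hA : ∀ k : ℕ, k ≠ 0 → (k : ℝ) < A → f k = 0) {t : ℝ}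
    (ht : t < A) : summatory f t = 0 := by
  refine Finset.sum_eq_zero fun k hk => ?_
  have hk0 : k ≠ 0 := (Nat.one_le_iff_ne_zero.1 (Finset.mem_Icc.1 hk).1)
  exact hA k hk0 (((Nat.le_floor_iff' hk0).1 (Finset.mem_Icc.1 hk).2).trans_lt ht)

theorem summatory_of_lt_one (f : ℕ → ℂ) {t : ℝ} (ht : t < 1) : summatory f t = 0 :=
  summatory_eq_zero (fun _ hk hk1 => absurd (Nat.cast_lt_one.1 hk1) hk) ht

theorem mellin_summatory_eq_integral_Ioi {A : ℝ} (hA0 : 0 < A)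
    (hA : ∀ k : ℕ, k ≠ 0 → (k : ℝ) < A → f k = 0) (s : ℂ) :
    mellin (summatory f) s = ∫ t in Set.Ioi A, (t : ℂ) ^ (s - 1) • summatory f t := by
  rw [← integral_Ici_eq_integral_Ioi, mellin]
  refine setIntegral_eq_of_subset_of_forall_sdiff_eq_zero measurableSet_Ioi
    (fun t (ht : A ≤ t) => hA0.trans_le ht) fun t ht => ?_
  rw [summatory_eq_zero hA (not_le.1 ht.2), smul_zero]

theorem differentiableAt_mellin_summatory (hB : ∀ t, ‖summatory f t‖ ≤ B) {s : ℂ}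
    (hs : s.re < 0) : DifferentiableAt ℂ (mellin (summatory f)) s := by
  have hloc : LocallyIntegrable (summatory f) volume :=
    (locallyIntegrable_const B).mono (measurable_summatory f).aestronglyMeasurable
      (Eventually.of_forall fun t => (hB t).trans (le_abs_self B))
  refine mellin_differentiableAt_of_isBigO_rpow (a := 0) (b := s.re - 1)
    (hloc.locallyIntegrableOn _) ?_ hs ?_ (sub_one_lt _)
  · refine Asymptotics.IsBigO.of_bound B (Eventually.of_forall fun t => ?_)
    simpa using hB t
  · refine (Asymptotics.isBigO_zero _ _).congr' ?_ EventuallyEq.rfl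
    filter_upwards [mem_nhdsWithin_of_mem_nhds (Iio_mem_nhds one_pos)] with t ht
    exact (summatory_of_lt_one f ht).symm

theorem LSeries_eq_mul_mellin (hB : ∀ t, ‖summatory f t‖ ≤ B) {z : ℂ} (hz : 0 < z.re)
    (hf : LSeriesSummable f z) : LSeries f z = z * mellin (summatory f) (-z) := by
  have hbigO : (fun n => ∑ k ∈ Finset.Icc 1 n, f k) =O[atTop] fun n => (n : ℝ) ^ (0 : ℝ) := by
    refine Asymptotics.IsBigO.of_bound B (Eventually.of_forall fun n => ?_)
    simpa [summatory] using hB n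
  rw [LSeries_eq_mul_integral f le_rfl hz hf hbigO,
    mellin_summatory_eq_integral_Ioi one_pos fun k hk hk1 => absurd (Nat.cast_lt_one.1 hk1) hk]
  simp only [summatory, smul_eq_mul, mul_comm, neg_add']

theorem eq_mul_mellin_of_lseriesHasSum {F : ℂ → ℂ} (hF : Differentiable ℂ F)
    (hB : ∀ t, ‖summatory f t‖ ≤ B) (hf : ∀ z : ℂ, 1 < z.re → LSeriesHasSum f z (F z)) {z : ℂ}
    (hz : 0 < z.re) : F z = z * mellin (summatory f) (-z) := by
  have hopen : IsOpen {z : ℂ | 0 < z.re} := isOpen_lt continuous_const Complex.continuous_re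
  have hmellin : DifferentiableOn ℂ (fun z => z * mellin (summatory f) (-z)) {z : ℂ | 0 < z.re} :=
    fun w (hw : 0 < w.re) => (differentiableAt_id.mul
      ((differentiableAt_mellin_summatory hB (s := -w) (by simpa using hw)).comp w
        differentiableAt_id.neg)).differentiableWithinAt
  refine (hF.differentiableOn.analyticOnNhd hopen).eqOn_of_preconnected_of_eventuallyEq
    (hmellin.analyticOnNhd hopen) (convex_halfSpace_re_gt 0).isPreconnected
    (z₀ := 2) (by simp) ?_ hz
  filter_upwards [(isOpen_lt continuous_const Complex.continuous_re).mem_nhds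
    (show (1 : ℝ) < (2 : ℂ).re by simp)] with w hw
  rw [← (hf w hw).LSeries_eq]
  exact LSeries_eq_mul_mellin hB (one_pos.trans hw) (hf w hw).LSeriesSummable

theorem norm_mellin_summatory_le (hB : ∀ t, ‖summatory f t‖ ≤ B) {A : ℝ} (hA0 : 0 < A)
    (hA : ∀ k : ℕ, k ≠ 0 → (k : ℝ) < A → f k = 0) {z : ℂ} (hz : 0 < z.re) :
    ‖mellin (summatory f) (-z)‖ ≤ B * A ^ (-z.re) / z.re := by
  have hlt : -z.re - 1 < -1 := by linarith
  calc ‖mellin (summatory f) (-z)‖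
      ≤ ∫ t in Set.Ioi A, B * t ^ (-z.re - 1) := by
        rw [mellin_summatory_eq_integral_Ioi hA0 hA]
        refine norm_integral_le_of_norm_le
          ((integrableOn_Ioi_rpow_of_lt hlt hA0).const_mul B) ?_
        filter_upwards [ae_restrict_mem measurableSet_Ioi] with t ht
        rw [norm_smul, Complex.norm_cpow_eq_rpow_re_of_pos (hA0.trans ht), mul_comm, Complex.sub_re,
          Complex.neg_re, Complex.one_re]
        exact mul_le_mul_of_nonneg_right (hB t) (Real.rpow_nonneg (hA0.trans ht).le _)
    _ = B * A ^ (-z.re) / z.re := by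
        rw [integral_const_mul, integral_Ioi_rpow_of_lt hlt hA0, sub_add_cancel, neg_div_neg_eq,
          mul_div_assoc]

end DirichletSeriesBound

section SinhQuot

theorem norm_sinh_le (z : ℂ) : ‖Complex.sinh z‖ ≤ Real.exp |z.re| := by
  rw [Complex.sinh, norm_div, Complex.norm_ofNat, div_le_iff₀ two_pos, mul_two]
  refine norm_sub_le_of_le ?_ ?_ <;> rw [Complex.norm_exp, Real.exp_le_exp]
  · exact le_abs_self _
  · exact neg_le_abs _

/-- The entire function `w ↦ sinh (ε w) / w`, used as a weight: it decays like `1 / |w|` on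
vertical lines at the cost of an exponential type `ε`. -/
def sinhQuot (ε : ℝ) : ℂ → ℂ := dslope (fun w : ℂ => Complex.sinh (ε * w)) 0

variable (ε : ℝ)

theorem sinhQuot_of_ne {w : ℂ} (hw : w ≠ 0) : sinhQuot ε w = Complex.sinh (ε * w) / w := by
  rw [sinhQuot, dslope_of_ne _ hw, slope_def_field, mul_zero, Complex.sinh_zero, sub_zero, sub_zero]

theorem sinhQuot_neg (w : ℂ) : sinhQuot ε (-w) = sinhQuot ε w := by
  rcases eq_or_ne w 0 with rfl | hw
  · rw [neg_zero]
  · rw [sinhQuot_of_ne ε hw, sinhQuot_of_ne ε (neg_ne_zero.2 hw), mul_neg, Complex.sinh_neg,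
      neg_div_neg_eq]

theorem differentiable_sinhQuot : Differentiable ℂ (sinhQuot ε) := by
  rw [← differentiableOn_univ, sinhQuot, Complex.differentiableOn_dslope univ_mem]
  have hsinh : Differentiable ℂ fun w : ℂ => Complex.sinh (ε * w) := by fun_prop
  exact hsinh.differentiableOn

theorem norm_mul_sinhQuot_le (w : ℂ) : ‖w‖ * ‖sinhQuot ε w‖ ≤ Real.exp |ε * w.re| := by
  rcases eq_or_ne w 0 with rfl | hw
  · rw [norm_zero, zero_mul]
    exact (Real.exp_pos _).le
  · rw [← norm_mul, sinhQuot_of_ne ε hw, mul_div_cancel₀ _ hw, ← Complex.re_ofReal_mul]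
    exact norm_sinh_le _

theorem exists_norm_sinhQuot_le : ∃ K : ℝ, 0 ≤ K ∧ ∀ w : ℂ,
    ‖sinhQuot ε w‖ ≤ K * Real.exp |ε * w.re| / (1 + ‖w‖) := by
  obtain ⟨B, hB⟩ := (isCompact_closedBall (0 : ℂ) 1).exists_bound_of_continuousOn
    (differentiable_sinhQuot ε).continuous.continuousOn
  have hB0 : 0 ≤ B := (norm_nonneg _).trans (hB 0 (by simp))
  refine ⟨B + 2, by positivity, fun w => ?_⟩
  have hexp : 1 ≤ Real.exp |ε * w.re| := Real.one_le_exp (abs_nonneg _)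
  have hmul := norm_mul_sinhQuot_le ε w
  have hnorm : ‖sinhQuot ε w‖ ≤ (B + 1) * Real.exp |ε * w.re| := by
    rcases le_total ‖w‖ 1 with hw | hw
    · have hw' := hB w (by simpa using hw)
      nlinarith
    · nlinarith [norm_nonneg (sinhQuot ε w)]
  rw [le_div_iff₀ (by positivity), mul_one_add, mul_comm _ ‖w‖]
  linarith

theorem sinhQuot_ofReal_ne_zero {ε : ℝ} (hε : ε ≠ 0) {x : ℝ} (hx : x ≠ 0) :
    sinhQuot ε x ≠ 0 := by
  rw [sinhQuot_of_ne ε (Complex.ofReal_ne_zero.2 hx), ← Complex.ofReal_mul, ← Complex.ofReal_sinh]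
  exact div_ne_zero (Complex.ofReal_ne_zero.2 fun h => mul_ne_zero hε hx (Real.sinh_eq_zero.1 h))
    (Complex.ofReal_ne_zero.2 hx)

end SinhQuot

section LFunction

variable {N : ℕ} [NeZero N] {Φ : ZMod N → ℂ}

theorem exists_norm_LFunction_le (hΦ : ∑ j, Φ j = 0) {A : ℕ} (hA0 : A ≠ 0)
    (hA : ∀ k < A, Φ (k : ZMod N) = 0) : ∃ B : ℝ, 0 ≤ B ∧ ∀ z : ℂ, 0 < z.re →
      ‖ZMod.LFunction Φ z‖ ≤ ‖z‖ * (B * (A : ℝ) ^ (-z.re) / z.re) := by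
  obtain ⟨B, hB⟩ := exists_norm_sum_Icc_le hΦ
  have hsum : ∀ t, ‖summatory (fun k => Φ (k : ZMod N)) t‖ ≤ B := fun t => hB _
  refine ⟨B, (norm_nonneg _).trans (hB 0), fun z hz => ?_⟩
  rw [eq_mul_mellin_of_lseriesHasSum (ZMod.differentiable_LFunction_of_sum_zero hΦ) hsum
    (fun w hw => ?_) hz, norm_mul]
  · gcongr
    exact norm_mellin_summatory_le hsum (by positivity)
      (fun k _ hk => hA k (Nat.cast_lt.1 hk)) hz
  · rw [ZMod.LFunction_eq_LSeries Φ hw]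
    exact (ZMod.LSeriesSummable_of_one_lt_re Φ hw).LSeriesHasSum

theorem LFunction_ne_zero (hΦ : Φ ≠ 0) : ZMod.LFunction Φ ≠ 0 := by
  refine mt (fun hL => ?_) hΦ
  have hzero : (fun x : ℝ => LSeries (fun k => Φ (k : ZMod N)) x) =ᶠ[atTop] 0 := by
    filter_upwards [eventually_gt_atTop 1] with x hx
    rw [← ZMod.LFunction_eq_LSeries Φ (by rwa [Complex.ofReal_re]), hL, Pi.zero_apply,
      Pi.zero_apply]
  rcases LSeries_eventually_eq_zero_iff'.1 hzero with hcoeff | htop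
  · ext j
    simpa using hcoeff (j.val + N) (by simp [NeZero.ne N])
  · have habs := LSeries.abscissaOfAbsConv_le_of_forall_lt_LSeriesSummable (x := 1) fun y hy =>
      ZMod.LSeriesSummable_of_one_lt_re Φ (s := y) (by rwa [Complex.ofReal_re])
    exact absurd (htop ▸ habs) (EReal.coe_lt_top 1).not_ge

theorem rho_none_mul_LFunction (hΦ : Φ.Even) {z : ℂ} (h0 : 0 < z.re) (h1 : z.re < 1) :
    rho none z * ZMod.LFunction Φ z = (N : ℂ) ^ (-z) * ZMod.LFunction (ZMod.dft Φ) (1 - z) := by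
  have hre : 0 < (1 - z).re := by rw [Complex.sub_re, Complex.one_re]; linarith
  have hz : z ≠ 0 := Complex.ne_zero_of_re_pos h0
  have hz' : 1 - z ≠ 0 := Complex.ne_zero_of_re_pos hre
  have hG := Complex.Gammaℝ_ne_zero_of_re_pos h0
  have hfun := ZMod.completedLFunction_one_sub_even hΦ (1 - z) (Or.inl hz')
    (Or.inl (by simpa using hz))
  rw [sub_sub_cancel, sub_sub_cancel_left] at hfun
  have hrho : rho none z = Complex.Gammaℝ z / Complex.Gammaℝ (1 - z) := rfl
  rw [hrho, ZMod.LFunction_eq_completed_div_gammaFactor_even hΦ z (Or.inl hz),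
    ZMod.LFunction_eq_completed_div_gammaFactor_even (ZMod.dft_even_iff.2 hΦ) _ (Or.inl hz'), hfun]
  field_simp

end LFunction

theorem mul_ne_zero_of_differentiable {f g : ℂ → ℂ} (hf : Differentiable ℂ f)
    (hg : Differentiable ℂ g) (hf0 : f ≠ 0) (hg0 : g ≠ 0) : f * g ≠ 0 := by
  intro hfg
  rcases AnalyticOnNhd.eq_zero_or_eq_zero_of_mul_eq_zero
    (hf.differentiableOn.analyticOnNhd isOpen_univ) (hg.differentiableOn.analyticOnNhd isOpen_univ)
    (fun z _ => congrFun hfg z) isPreconnected_univ with h | h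
  · exact hf0 (funext fun z => h z trivial)
  · exact hg0 (funext fun z => h z trivial)

theorem linearIndependent_cexp :
    LinearIndependent ℂ fun δ z : ℂ => Complex.exp (δ * z) := by
  let expHom : ℂ → Multiplicative ℂ →* ℂ := fun δ =>
    Complex.expMonoidHom.comp (AddMonoidHom.toMultiplicative (AddMonoidHom.mulLeft δ))
  have hinj : Function.Injective expHom := fun δ δ' h => by
    have hfun : (fun z : ℂ => Complex.exp (δ * z)) = fun z : ℂ => Complex.exp (δ' * z) :=
      congrArg (DFunLike.coe (F := Multiplicative ℂ →* ℂ)) h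
    have hderiv : ∀ c : ℂ, HasDerivAt (fun z : ℂ => Complex.exp (c * z)) c 0 := fun c => by
      simpa using ((hasDerivAt_id (0 : ℂ)).const_mul c).cexp
    exact (hderiv δ).unique (hfun ▸ hderiv δ')
  exact (linearIndependent_monoidHom (Multiplicative ℂ) ℂ).comp expHom hinj

theorem linearIndependent_cexp_mul {G : ℂ → ℂ} (hG : Differentiable ℂ G) (hG0 : G ≠ 0) :
    LinearIndependent ℂ fun δ z : ℂ => Complex.exp (δ * z) * G z := by
  refine linearIndependent_cexp.map (f := LinearMap.mulRight ℂ G) ?_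
  have hdiff : ∀ f ∈ Submodule.span ℂ (Set.range fun δ z : ℂ => Complex.exp (δ * z)),
      Differentiable ℂ f := fun f hf => by
    induction hf using Submodule.span_induction with
    | mem f hf =>
      obtain ⟨δ, rfl⟩ := hf
      fun_prop
    | zero => exact differentiable_const 0
    | add f g _ _ hf hg => exact hf.add hg
    | smul c f _ hf => exact hf.const_smul c
  exact Submodule.disjoint_def.2 fun f hf hfG => by_contra fun hf0 =>
    mul_ne_zero_of_differentiable (hdiff f hf) hG hf0 hG0 (LinearMap.mem_ker.1 hfG)

section WeightedLFunction

theorem memLp_two_div_one_add_abs (K : ℝ) : MemLp (fun s : ℝ => K / (1 + |s|)) 2 volume := by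
  have hcont : Continuous fun s : ℝ => K / (1 + |s|) :=
    continuous_const.div (by fun_prop) fun s => by positivity
  rw [memLp_two_iff_integrable_sq hcont.aestronglyMeasurable]
  refine (integrable_inv_one_add_sq.const_mul (K ^ 2)).mono' (hcont.pow 2).aestronglyMeasurable
    (Eventually.of_forall fun s => ?_)
  rw [Real.norm_of_nonneg (sq_nonneg _), div_pow, div_eq_mul_inv]
  gcongr
  nlinarith [abs_nonneg s, sq_abs s]

variable {a : ℕ} [NeZero a] {Φ : ZMod (a ^ 2) → ℂ}

/-- The product of `a ^ z L(Φ, z)` and a weight of quadratic decay on vertical lines; the power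
`a ^ z` makes it self-dual under `z ↦ 1 - z`, up to the factor `ρ_∞`. -/
def weightedLFunction (Φ : ZMod (a ^ 2) → ℂ) (z : ℂ) : ℂ :=
  sinhQuot (1 / 4) (z - 1 / 2) ^ 2 * ((a : ℂ) ^ z * ZMod.LFunction Φ z)

theorem differentiable_weightedLFunction (hΦ : ∑ j, Φ j = 0) :
    Differentiable ℂ (weightedLFunction Φ) :=
  (((differentiable_sinhQuot _).comp (differentiable_id.sub_const _)).pow 2).mul
    ((differentiable_id.const_cpow (Or.inl (NeZero.ne _))).mul
      (ZMod.differentiable_LFunction_of_sum_zero hΦ))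

theorem weightedLFunction_ne_zero (hsum : ∑ j, Φ j = 0) (hΦ : Φ ≠ 0) :
    weightedLFunction Φ ≠ 0 := by
  have hsinh : Differentiable ℂ fun z : ℂ => sinhQuot (1 / 4) (z - 1 / 2) ^ 2 :=
    ((differentiable_sinhQuot _).comp (differentiable_id.sub_const _)).pow 2
  have hpow : Differentiable ℂ fun z : ℂ => (a : ℂ) ^ z :=
    differentiable_id.const_cpow (Or.inl (NeZero.ne _))
  have hL := ZMod.differentiable_LFunction_of_sum_zero hsum
  refine mul_ne_zero_of_differentiable hsinh (hpow.mul hL) (fun h => ?_)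
    (mul_ne_zero_of_differentiable hpow hL (fun h => ?_) (LFunction_ne_zero hΦ))
  · have h1 : sinhQuot (1 / 4) ((1 / 2 : ℝ) : ℂ) ^ 2 = 0 := by
      simpa [show (1 : ℂ) - 2⁻¹ = 2⁻¹ by norm_num] using congrFun h 1
    exact sinhQuot_ofReal_ne_zero (by norm_num) (by norm_num) (pow_eq_zero_iff two_ne_zero |>.1 h1)
  · simpa using congrFun h 0

theorem rho_none_mul_weightedLFunction (hΦ : Φ.Even) {z : ℂ} (h0 : 0 < z.re) (h1 : z.re < 1) :
    rho none z * weightedLFunction Φ z =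
      (a : ℂ)⁻¹ * weightedLFunction (ZMod.dft Φ) (1 - z) := by
  have ha : (a : ℂ) ≠ 0 := NeZero.ne _
  have hpow : (a : ℂ) ^ z * ((a ^ 2 : ℕ) : ℂ) ^ (-z) = (a : ℂ)⁻¹ * (a : ℂ) ^ (1 - z) := by
    rw [pow_two, Nat.cast_mul, Complex.natCast_mul_natCast_cpow, ← mul_assoc,
      ← Complex.cpow_add _ _ ha, add_neg_cancel, Complex.cpow_zero, one_mul,
      Complex.cpow_sub _ _ ha, Complex.cpow_one, Complex.cpow_neg]
    field_simp
  have hsinh : sinhQuot (1 / 4) (1 - z - 1 / 2) = sinhQuot (1 / 4) (z - 1 / 2) := by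
    rw [← sinhQuot_neg]
    ring_nf
  calc rho none z * weightedLFunction Φ z
      = sinhQuot (1 / 4) (z - 1 / 2) ^ 2 * ((a : ℂ) ^ z * (rho none z * ZMod.LFunction Φ z)) := by
        rw [weightedLFunction]
        ring
    _ = _ := by
        rw [rho_none_mul_LFunction hΦ h0 h1, ← mul_assoc _ (_ ^ (-z)), hpow, weightedLFunction,
          hsinh]
        ring

theorem rpow_mul_mul_rpow_neg_le (a : ℕ) [NeZero a] {σ : ℝ} (hσ : 0 ≤ σ) :
    (a : ℝ) ^ σ * ((3 * a : ℕ) : ℝ) ^ (-σ) ≤ Real.exp (-σ) := by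
  have ha : (a : ℝ) ^ σ ≠ 0 := (Real.rpow_pos_of_pos (Nat.cast_pos.2 (NeZero.pos a)) _).ne'
  rw [Nat.cast_mul, Nat.cast_ofNat, Real.mul_rpow (by norm_num) a.cast_nonneg, mul_left_comm,
    Real.rpow_neg a.cast_nonneg, mul_inv_cancel₀ ha, mul_one, ← Real.exp_one_rpow]
  exact Real.rpow_le_rpow_of_nonpos (Real.exp_pos 1) Real.exp_one_lt_three.le (neg_nonpos.2 hσ)

theorem exists_norm_sinhQuot_sq_le : ∃ K : ℝ, 0 ≤ K ∧ ∀ z : ℂ, 1 / 2 ≤ z.re →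
    ‖sinhQuot (1 / 4) (z - 1 / 2) ^ 2‖ ≤ K * Real.exp (z.re / 2) / (1 + ‖z - 1 / 2‖) ^ 2 := by
  obtain ⟨K, hK, hsinh⟩ := exists_norm_sinhQuot_le (1 / 4)
  refine ⟨K ^ 2, by positivity, fun z hz => ?_⟩
  have hre : |1 / 4 * (z - 1 / 2).re| ≤ z.re / 4 := by
    rw [show (z - 1 / 2).re = z.re - 1 / 2 by norm_num, abs_of_nonneg (by linarith)]
    linarith
  calc ‖sinhQuot (1 / 4) (z - 1 / 2) ^ 2‖
      ≤ (K * Real.exp (z.re / 4) / (1 + ‖z - 1 / 2‖)) ^ 2 := by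
        rw [norm_pow]
        gcongr
        refine (hsinh _).trans ?_
        gcongr
    _ = _ := by
        rw [div_pow, mul_pow, ← Real.exp_nat_mul]
        ring_nf

theorem exists_norm_cpow_mul_LFunction_le (hsum : ∑ j, Φ j = 0)
    (hΦ : ∀ k < 3 * a, Φ (k : ZMod (a ^ 2)) = 0) : ∃ B : ℝ, 0 ≤ B ∧ ∀ z : ℂ, 1 / 2 ≤ z.re →
      ‖(a : ℂ) ^ z * ZMod.LFunction Φ z‖ ≤ B * Real.exp (-z.re) * (1 + ‖z - 1 / 2‖) := by
  obtain ⟨B, hB, hL⟩ := exists_norm_LFunction_le hsum (by simp [NeZero.ne a]) hΦ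
  refine ⟨2 * B, by positivity, fun z hz => ?_⟩
  have hnorm : ‖z‖ ≤ 1 + ‖z - 1 / 2‖ := by
    have hhalf : ‖(1 / 2 : ℂ)‖ ≤ 1 := by norm_num
    calc ‖z‖ = ‖1 / 2 + (z - 1 / 2)‖ := by rw [add_sub_cancel]
      _ ≤ 1 + ‖z - 1 / 2‖ := (norm_add_le _ _).trans (add_le_add_left hhalf _)
  have hinv : 1 / z.re ≤ 2 := (div_le_iff₀ (by linarith)).2 (by linarith)
  rw [norm_mul, Complex.norm_natCast_cpow_of_pos (NeZero.pos a)]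
  calc (a : ℝ) ^ z.re * ‖ZMod.LFunction Φ z‖
      ≤ (a : ℝ) ^ z.re * (‖z‖ * (B * ((3 * a : ℕ) : ℝ) ^ (-z.re) / z.re)) := by
        gcongr
        exact hL z (by linarith)
    _ = 1 / z.re * B * ((a : ℝ) ^ z.re * ((3 * a : ℕ) : ℝ) ^ (-z.re)) * ‖z‖ := by ring
    _ ≤ 2 * B * Real.exp (-z.re) * (1 + ‖z - 1 / 2‖) := by
        gcongr
        exact rpow_mul_mul_rpow_neg_le a (by linarith)

theorem exists_norm_weightedLFunction_le (hsum : ∑ j, Φ j = 0)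
    (hΦ : ∀ k < 3 * a, Φ (k : ZMod (a ^ 2)) = 0) : ∃ C : ℝ, 0 ≤ C ∧ ∀ z : ℂ, 1 / 2 ≤ z.re →
      ‖weightedLFunction Φ z‖ ≤ C * Real.exp (-(z.re / 2)) / (1 + |z.im|) := by
  obtain ⟨K, hK, hsinh⟩ := exists_norm_sinhQuot_sq_le
  obtain ⟨B, hB, hL⟩ := exists_norm_cpow_mul_LFunction_le hsum hΦ
  refine ⟨K * B, by positivity, fun z hz => ?_⟩
  have him : |z.im| ≤ ‖z - 1 / 2‖ := by simpa using Complex.abs_im_le_norm (z - 1 / 2)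
  have hexp : Real.exp (z.re / 2) * Real.exp (-z.re) = Real.exp (-(z.re / 2)) := by
    rw [← Real.exp_add]
    ring_nf
  calc ‖weightedLFunction Φ z‖
      ≤ K * Real.exp (z.re / 2) / (1 + ‖z - 1 / 2‖) ^ 2 *
          (B * Real.exp (-z.re) * (1 + ‖z - 1 / 2‖)) := by
        rw [weightedLFunction, norm_mul]
        exact mul_le_mul (hsinh z hz) (hL z hz) (norm_nonneg _) (by positivity)
    _ = K * B * Real.exp (-(z.re / 2)) / (1 + ‖z - 1 / 2‖) := by
        rw [← hexp]
        field_simp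
    _ ≤ K * B * Real.exp (-(z.re / 2)) / (1 + |z.im|) := by gcongr

theorem cexp_mul_weightedLFunction_mem_dominated {δ : ℝ} (hδ : δ ≤ 1 / 2) (hsum : ∑ j, Φ j = 0)
    (hΦ : ∀ k < 3 * a, Φ (k : ZMod (a ^ 2)) = 0) :
    (fun z : ℂ => Complex.exp (δ * z) * weightedLFunction Φ z) ∈ dominated := by
  obtain ⟨C, hC, hbound⟩ := exists_norm_weightedLFunction_le hsum hΦ
  have hexp : Differentiable ℂ fun z : ℂ => Complex.exp (δ * z) := by fun_prop
  refine ⟨hexp.mul (differentiable_weightedLFunction hsum), _, memLp_two_div_one_add_abs C,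
    fun z hz => ?_⟩
  have hle : Real.exp (δ * z.re) * Real.exp (-(z.re / 2)) ≤ 1 := by
    rw [← Real.exp_add, Real.exp_le_one_iff]
    nlinarith
  calc ‖Complex.exp (δ * z) * weightedLFunction Φ z‖
      ≤ Real.exp (δ * z.re) * (C * Real.exp (-(z.re / 2)) / (1 + |z.im|)) := by
        rw [norm_mul, Complex.norm_exp, Complex.re_ofReal_mul]
        gcongr
        exact hbound z hz
    _ = C / (1 + |z.im|) * (Real.exp (δ * z.re) * Real.exp (-(z.re / 2))) := by ring
    _ ≤ C / (1 + |z.im|) := mul_le_of_le_one_right (by positivity) hle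

theorem cexp_mul_weightedLFunction_mem_soninEntire {δ : ℝ} (hδ : |δ| ≤ 1 / 2) (heven : Φ.Even)
    (ha : ∀ k < 3 * a, Φ (k : ZMod (a ^ 2)) = 0)
    (ha' : ∀ k < 3 * a, ZMod.dft Φ (k : ZMod (a ^ 2)) = 0) :
    (fun z : ℂ => Complex.exp (δ * z) * weightedLFunction Φ z) ∈ soninEntire := by
  have ha0 : 0 < 3 * a := by have := NeZero.pos a; omega
  have hΦ0 : Φ 0 = 0 := by simpa using ha 0 ha0
  have hdft0 : ZMod.dft Φ 0 = 0 := by simpa using ha' 0 ha0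
  have hsum : ∑ j, Φ j = 0 := by rw [← ZMod.dft_apply_zero, hdft0]
  have hsum' : ∑ j, ZMod.dft Φ j = 0 := by
    simp only [← ZMod.dft_apply_zero, ZMod.dft_dft, neg_zero, hΦ0, smul_zero]
  refine ⟨cexp_mul_weightedLFunction_mem_dominated (abs_le.1 hδ).2 hsum ha, _,
    dominated.smul_mem (Complex.exp δ * (a : ℂ)⁻¹) (cexp_mul_weightedLFunction_mem_dominated
      (neg_le.1 (abs_le.1 hδ).1) hsum' ha'), fun s => ?_⟩
  have hfun := rho_none_mul_weightedLFunction heven (z := crit s) (by rw [crit_re]; norm_num)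
    (by rw [crit_re]; norm_num)
  have hexp : Complex.exp δ * Complex.exp ((-δ : ℝ) * (1 - crit s)) = Complex.exp (δ * crit s) := by
    rw [← Complex.exp_add]
    congr 1
    push_cast
    ring
  rw [mul_left_comm, hfun, Pi.smul_apply, smul_eq_mul, ← hexp]
  ring

theorem not_finiteDimensional_soninEntire : ¬ FiniteDimensional ℂ soninEntire := by
  intro hfin
  obtain ⟨Φ, hΦ0, heven, hΦ, hdft⟩ :=
    exists_even_eq_zero_dft_eq_zero (N := 13 ^ 2) (A := 3 * 13) (by norm_num)
  have hsum : ∑ j, Φ j = 0 := by rw [← ZMod.dft_apply_zero]; simpa using hdft 0 (by norm_num)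
  have hindep := linearIndependent_cexp_mul (differentiable_weightedLFunction hsum)
    (weightedLFunction_ne_zero hsum hΦ0)
  let family : Set.Icc (-(1 / 2) : ℝ) (1 / 2) → soninEntire := fun δ =>
    ⟨_, cexp_mul_weightedLFunction_mem_soninEntire (abs_le.2 δ.2) heven hΦ hdft⟩
  have hfamily : LinearIndependent ℂ family := LinearIndependent.of_comp soninEntire.subtype
    (hindep.comp (fun δ : Set.Icc (-(1 / 2) : ℝ) (1 / 2) => ((δ : ℝ) : ℂ))
      (Complex.ofReal_injective.comp Subtype.val_injective))
  exact (Set.Icc_infinite (by norm_num)).not_finite hfamily.finite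

end WeightedLFunction

theorem not_finiteDimensional_sonin (F : FinPlaces) :
    ¬ FiniteDimensional ℂ (sonin (uF F.1)) := by
  intro hF
  have hle : (⟨{none}, Finset.mem_singleton_self _⟩ : FinPlaces) ≤ F :=
    Finset.singleton_subset_iff.2 F.2
  have hfin : FiniteDimensional ℂ (sonin (uF {none})) :=
    FiniteDimensional.of_injective _ (soninMap_injective _ F hle)
  exact not_finiteDimensional_soninEntire (FiniteDimensional.of_injective _ toSonin_injective)

end SemilocalSonin

end

theorem mainTheorem2 :
    (∀ F : FinPlaces, ¬ FiniteDimensional ℂ (sonin (uF F.1))) ∧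
    (∃ T : ∀ F F' : FinPlaces, F ≤ F' → (sonin (uF F.1) →ₗ[ℂ] sonin (uF F'.1)),
      (∀ (F F' : FinPlaces) (h : F ≤ F') (ξ : sonin (uF F.1)),
        (((T F F' h ξ : L2) : ℝ → ℂ) =ᵐ[volume]
          fun s : ℝ => dProd F.1 F'.1 (crit s) * (ξ : L2) s)) ∧
      (∀ (F F' : FinPlaces) (h : F ≤ F'), Function.Injective (T F F' h)) ∧
      DirectedSystem (fun F : FinPlaces => sonin (uF F.1)) (fun F F' h => T F F' h)) ∧
    IsDirectedOrder FinPlaces :=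
  ⟨not_finiteDimensional_sonin, ⟨soninMap, soninMap_apply, soninMap_injective,
    directedSystem_soninMap⟩, isDirectedOrder_finPlaces⟩
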